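/- Let $\mathrm{SSI}^n_{a,b}:\{0,1\}^n\times\{0,1\}^n\to\mathbb Z\cup\{?\}$ be the partial function with $\mathrm{SSI}^n_{a,b}(x,y)=|x\wedge y|$ if $|x|=a$ and $|y|=b$, and $\mathrm{SSI}^n_{a,b}(x,y)=\,?$ otherwise, where $|\cdot|$ is the Hamming weight. For a partial function $f$, let $R(f)$ be the least worst-case number of bits exchanged by a two-party protocol with public randomness that, on every input $(x,y)$ with $f(x,y)\neq\,?$, outputs $f(x,y)$ with probability at least $2/3$. Let $\mathrm{ISR}_\rho(f)$ be the same quantity for protocols in which, instead of public randomness, Alice sees $r_1,\dots,r_t$ and Bob sees $s_1,\dots,s_t$ for some finite $t$, where the pairs $(r_i,s_i)\in\{0,1\}^2$ are independent with $\Pr[r_i=s_i=0]=\Pr[r_i=s_i=1]=(1+\rho)/4$ and $\Pr[r_i=0,s_i=1]=\Pr[r_i=1,s_i=0]=(1-\rho)/4$. In the two-way model, the output is produced by one of the parties, determined by the transcript. Let $R^{1\text{-way}}$ and $\mathrm{ISR}^{1\text{-way}}_\rho$ be the corresponding quantities for protocols in which only Alice sends bits and Bob produces the output. There is an absolute constant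 $c>0$, and for every $\rho\in(0,1]$ a constant $C=C(\rho)>0$, such that for all integers $n$ and $a,b\ge 1$ with $a,b\le n/2$, $$c\max\{a,\log_2 b\}\ \le\ R^{1\text{-way}}(\mathrm{SSI}^n_{a,b})\ \le\ \mathrm{ISR}^{1\text{-way}}_\rho(\mathrm{SSI}^n_{a,b})\ \le\ C\,a\max\{1,\log_2(ab)\},$$ and, if moreover $a\le b$, $$c\max\{a,\log_2 b\}\ \le\ R(\mathrm{SSI}^n_{a,b})\ \le\ \mathrm{ISR}_\rho(\mathrm{SSI}^n_{a,b})\ \le\ C\,a\max\{1,\log_2(ab)\}.$$ -/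

import Mathlib

namespace SmallSet

/-- Deterministic two-party protocol trees. Alice's view ranges over `A`, Bob's over `B`.
At a `Sends` node one party sends one bit computed from its view (the position in the tree
encodes the transcript so far). At a leaf one party, determined by the transcript, produces the
output from its view. -/
inductive Protocol (A B Z : Type) : Type
  | aliceOutputs (out : A → Z) : Protocol A B Z
  | bobOutputs (out : B → Z) : Protocol A B Z
  | aliceSends (bit : A → Bool) (next : Bool → Protocol A B Z) : Protocol A B Z
  | bobSends (bit : B → Bool) (next : Bool → Protocol A B Z) : Protocol A B Z

namespace Protocol

variable {A B Z : Type}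

/-- The output of the protocol on a pair of views. -/
def eval : Protocol A B Z → A → B → Z
  | aliceOutputs out, α, _ => out α
  | bobOutputs out, _, β => out β
  | aliceSends bit next, α, β => (next (bit α)).eval α β
  | bobSends bit next, α, β => (next (bit β)).eval α β

/-- The worst-case number of bits exchanged. -/
def cost : Protocol A B Z → ℕ
  | aliceOutputs _ => 0
  | bobOutputs _ => 0
  | aliceSends _ next => max (next false).cost (next true).cost + 1
  | bobSends _ next => max (next false).cost (next true).cost + 1

/-- One-way protocols: only Alice sends bits, and Bob produces the output. -/
def IsOneWay : Protocol A B Z → Prop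
  | aliceOutputs _ => False
  | bobOutputs _ => True
  | aliceSends _ next => ∀ c, (next c).IsOneWay
  | bobSends _ _ => False

end Protocol

/-- The two communication models. -/
inductive CommModel : Type
  | oneWay
  | twoWay

/-- The protocols that a communication model allows. -/
def Protocol.Allowed {A B Z : Type} : CommModel → Protocol A B Z → Prop
  | .oneWay, P => P.IsOneWay
  | .twoWay, _ => True

/-- Bit strings of length `n`. -/
abbrev BitStr (n : ℕ) : Type := Fin n → Bool

/-- `P` computes the partial function `f` (`none` stands for `?`) with probability at least `2/3`
on every input, using public randomness `ω : Ω` of distribution `p`. -/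
def ComputesPublic {X Y Z Ω : Type} [DecidableEq Z] [Fintype Ω]
    (p : Ω → ℝ) (P : Protocol (X × Ω) (Y × Ω) Z) (f : X → Y → Option Z) : Prop :=
  ∀ x y z, f x y = some z →
    2 / 3 ≤ ∑ ω, if P.eval (x, ω) (y, ω) = z then p ω else 0

/-- `k` bits suffice for a public-coin protocol for `f` in the model `M`. The public random
string has an arbitrary distribution on an arbitrary finite set. -/
def PublicAchievable {X Y Z : Type} [DecidableEq Z]
    (M : CommModel) (f : X → Y → Option Z) (k : ℕ) : Prop :=
  ∃ (Ω : Type) (_ : Fintype Ω) (p : Ω → ℝ) (P : Protocol (X × Ω) (Y × Ω) Z),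
    p ∈ stdSimplex ℝ Ω ∧ P.Allowed M ∧ P.cost = k ∧ ComputesPublic p P f

/-- The doubly symmetric binary source with parameter `ρ`. -/
noncomputable def dsbs (ρ : ℝ) (r s : Bool) : ℝ :=
  if r = s then (1 + ρ) / 4 else (1 - ρ) / 4

/-- The probability that `t` independent samples of the source with parameter `ρ` give Alice the
string `r` and Bob the string `s`. -/
noncomputable def dsbsString (ρ : ℝ) {t : ℕ} (r s : BitStr t) : ℝ :=
  ∏ i, dsbs ρ (r i) (s i)

/-- `P` computes the partial function `f` with probability at least `2/3` on every input, where
Alice sees `r` and Bob sees `s` for `t` independent samples of the source with parameter `ρ`. -/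
def ComputesISR {X Y Z : Type} [DecidableEq Z] (ρ : ℝ) {t : ℕ}
    (P : Protocol (X × BitStr t) (Y × BitStr t) Z) (f : X → Y → Option Z) : Prop :=
  ∀ x y z, f x y = some z →
    2 / 3 ≤ ∑ r : BitStr t, ∑ s : BitStr t,
      if P.eval (x, r) (y, s) = z then dsbsString ρ r s else 0

/-- `k` bits suffice for a protocol for `f` in the model `M` with imperfectly shared randomness
of correlation `ρ`. -/
def ISRAchievable {X Y Z : Type} [DecidableEq Z]
    (M : CommModel) (ρ : ℝ) (f : X → Y → Option Z) (k : ℕ) : Prop :=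
  ∃ (t : ℕ) (P : Protocol (X × BitStr t) (Y × BitStr t) Z),
    P.Allowed M ∧ P.cost = k ∧ ComputesISR ρ P f

/-- Randomized communication complexity with public randomness. The set is nonempty for inputs
that are bit strings (`exists_publicAchievable`), so that this is a minimum. -/
noncomputable def randCC {X Y Z : Type} [DecidableEq Z]
    (M : CommModel) (f : X → Y → Option Z) : ℕ :=
  sInf {k | PublicAchievable M f k}

/-- Communication complexity with imperfectly shared randomness of correlation `ρ`. The set is
nonempty for inputs that are bit strings (`exists_isrAchievable`), so that this is a minimum. -/
noncomputable def isrCC {X Y Z : Type} [DecidableEq Z]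
    (M : CommModel) (ρ : ℝ) (f : X → Y → Option Z) : ℕ :=
  sInf {k | ISRAchievable M ρ f k}

/-- Hamming weight. -/
def weight {n : ℕ} (x : BitStr n) : ℕ :=
  (Finset.univ.filter fun i => x i = true).card

/-- Bitwise conjunction. -/
def bitAnd {n : ℕ} (x y : BitStr n) : BitStr n := fun i => x i && y i

/-- Small-Set-Intersection. -/
def ssi (n a b : ℕ) (x y : BitStr n) : Option ℤ :=
  if weight x = a ∧ weight y = b then some (weight (bitAnd x y) : ℤ) else none

section Attained

/-- Alice sends the listed bits of her view, then Bob outputs. -/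
def Protocol.sendBits {A B Z : Type} :
    List (A → Bool) → (List Bool → B → Z) → Protocol A B Z
  | [], out => .bobOutputs (out [])
  | m :: l, out => .aliceSends m fun c => sendBits l fun w => out (c :: w)

theorem Protocol.eval_sendBits {A B Z : Type} (l : List (A → Bool)) (out : List Bool → B → Z)
    (α : A) (β : B) : (sendBits l out).eval α β = out (l.map fun m => m α) β := by
  induction l generalizing out with
  | nil => rfl
  | cons m l ih => simp [sendBits, eval, ih]

theorem Protocol.isOneWay_sendBits {A B Z : Type} (l : List (A → Bool))
    (out : List Bool → B → Z) : (sendBits l out).IsOneWay := by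
  induction l generalizing out with
  | nil => trivial
  | cons m l ih => exact fun c => ih _

theorem exists_exact_protocol {n : ℕ} {Y Z R S : Type} [Inhabited Z]
    (M : CommModel) (f : BitStr n → Y → Option Z) :
    ∃ P : Protocol (BitStr n × R) (Y × S) Z,
      P.Allowed M ∧ ∀ x y z r s, f x y = some z → P.eval (x, r) (y, s) = z := by
  refine ⟨Protocol.sendBits (List.ofFn fun (i : Fin n) (α : BitStr n × R) => α.1 i)
    fun w β => (f (fun i => w.getD i false) β.1).getD default, ?_, ?_⟩
  · cases M
    · exact Protocol.isOneWay_sendBits _ _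
    · trivial
  · intro x y z r s h
    rw [Protocol.eval_sendBits]
    have hx : (fun i : Fin n => ((List.ofFn fun (i : Fin n) (α : BitStr n × R) => α.1 i).map
        fun m => m (x, r)).getD i false) = x := by
      funext i
      simp [List.getD_eq_getElem?_getD]
    simp only [hx, h, Option.getD_some]

theorem sum_dsbsString (ρ : ℝ) (t : ℕ) :
    ∑ r : BitStr t, ∑ s : BitStr t, dsbsString ρ r s = 1 := by
  have h : ∀ r : BitStr t, ∑ s : BitStr t, dsbsString ρ r s = ∏ i, ∑ c, dsbs ρ (r i) c := by
    intro r
    exact (Fintype.prod_sum fun i c => dsbs ρ (r i) c).symm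
  have h2 : ∀ c, ∑ d, dsbs ρ c d = 1 / 2 := by
    intro c
    cases c <;> simp [dsbs] <;> ring
  simp only [h, h2]
  simp

theorem exists_publicAchievable {n : ℕ} {Y Z : Type} [DecidableEq Z] [Inhabited Z]
    (M : CommModel) (f : BitStr n → Y → Option Z) : ∃ k, PublicAchievable M f k := by
  obtain ⟨P, hM, hP⟩ := exists_exact_protocol (R := Unit) (S := Unit) M f
  refine ⟨P.cost, Unit, inferInstance, fun _ => 1, P, ⟨by simp, by simp⟩, hM, rfl, ?_⟩
  intro x y z h
  simp only [hP x y z _ _ h]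
  norm_num

theorem exists_isrAchievable {n : ℕ} {Y Z : Type} [DecidableEq Z] [Inhabited Z]
    (M : CommModel) (ρ : ℝ) (f : BitStr n → Y → Option Z) : ∃ k, ISRAchievable M ρ f k := by
  obtain ⟨P, hM, hP⟩ := exists_exact_protocol (R := BitStr 0) (S := BitStr 0) M f
  refine ⟨P.cost, 0, P, hM, rfl, ?_⟩
  intro x y z h
  simp only [hP x y z _ _ h, if_true, sum_dsbsString]
  norm_num

end Attained

end SmallSet

/-! Public randomness can simulate a correlated source, and a one-way protocol is a two-way
protocol, so what remains is an upper bound for one-way protocols with imperfect randomness and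
lower bounds for public coins.

Upper bound (`isrAchievable_oneWay_ssi`): the source assigns to each position `i` a column of `L`
bits, one version for each party. Alice sends her columns at the `a` positions of her set. Bob
counts those `j` in his set whose column has empirical correlation at least `ρ * L / 2` with some
received column. The expected correlation is `ρ * L` for equal positions and `0` otherwise, so a
Chernoff bound (`sum_wrong_le`) and a union bound over `a * b` pairs show that `L` of order `log (a
* b) / ρ ^ 2` suffices.

Lower bounds: averaging fixes the public coins, leaving a deterministic protocol right on two thirds
of a chosen family of inputs. Padding (`exists_ssi_encoding`) embeds three hard problems. For `b ≤
a` and one-way protocols, Bob asks for one bit of a string of length `a / 2` held by Alice. Few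
messages cannot describe a random string with advantage (`div_le_log_card_of_guess`), so the cost is
linear in `a`. For `a ≤ b` and two-way protocols, Alice asks for one bit of a string of length `b /
2` held by Bob. A protocol of cost `k` gives Bob at most `2 ^ 2 ^ (k + 1)` strategies
(`Protocol.exists_strategies`), and the same guessing bound gives `log b`. For `a ≤ b`, the parity
of the intersection is the inner product on `a / 2` bits, whose discrepancy is small
(`Protocol.abs_sum_ipSign_le`), so the cost is linear in `a`. The one-way bound for `a ≤ b` is
inherited from the two-way one; for `b ≤ a` the term `log b` is at most `a`. -/

namespace SmallSet

open Finset

/-! ### Operations on protocols -/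

namespace Protocol

variable {A B A' B' Z : Type}

/-- The protocol run on views that are computed from other views. -/
def comap (f : A' → A) (g : B' → B) : Protocol A B Z → Protocol A' B' Z
  | aliceOutputs out => aliceOutputs (out ∘ f)
  | bobOutputs out => bobOutputs (out ∘ g)
  | aliceSends bit next => aliceSends (bit ∘ f) fun c => (next c).comap f g
  | bobSends bit next => bobSends (bit ∘ g) fun c => (next c).comap f g

theorem eval_comap (f : A' → A) (g : B' → B) (P : Protocol A B Z) (α : A') (β : B') :
    (P.comap f g).eval α β = P.eval (f α) (g β) := by
  induction P with
  | aliceOutputs out => rfl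
  | bobOutputs out => rfl
  | aliceSends bit next ih => exact ih _
  | bobSends bit next ih => exact ih _

theorem cost_comap (f : A' → A) (g : B' → B) (P : Protocol A B Z) :
    (P.comap f g).cost = P.cost := by
  induction P with
  | aliceOutputs out => rfl
  | bobOutputs out => rfl
  | aliceSends bit next ih => simp only [comap, cost, ih]
  | bobSends bit next ih => simp only [comap, cost, ih]

theorem isOneWay_comap (f : A' → A) (g : B' → B) {P : Protocol A B Z} (h : P.IsOneWay) :
    (P.comap f g).IsOneWay := by
  induction P with
  | aliceOutputs out => exact h
  | bobOutputs out => trivial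
  | aliceSends bit next ih => exact fun c => ih c (h c)
  | bobSends bit next ih => exact h

theorem allowed_comap (f : A' → A) (g : B' → B) {M : CommModel} {P : Protocol A B Z}
    (h : P.Allowed M) : (P.comap f g).Allowed M := by
  cases M
  · exact isOneWay_comap f g h
  · trivial

theorem cost_sendBits (l : List (A → Bool)) (out : List Bool → B → Z) :
    (sendBits l out).cost = l.length := by
  induction l generalizing out with
  | nil => rfl
  | cons m l ih => simp [sendBits, cost, ih]

/-- A message of `K` bits can be sent by a one-way protocol of cost `K`. -/
theorem exists_oneWay_of_message {K : ℕ} (msg : A → BitStr K) (out : BitStr K → B → Z) :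
    ∃ P : Protocol A B Z, P.IsOneWay ∧ P.cost = K ∧ ∀ α β, P.eval α β = out (msg α) β := by
  refine ⟨sendBits (List.ofFn fun (i : Fin K) (α : A) => msg α i)
    fun w β => out (fun i => w.getD i false) β, isOneWay_sendBits _ _, ?_, fun α β => ?_⟩
  · rw [cost_sendBits, List.length_ofFn]
  · rw [eval_sendBits]
    congr 1
    funext i
    simp [List.getD_eq_getElem?_getD]

end Protocol

/-! ### Comparison of the four complexity measures -/

theorem dsbs_nonneg {ρ : ℝ} (h0 : 0 ≤ ρ) (h1 : ρ ≤ 1) (c d : Bool) : 0 ≤ dsbs ρ c d := by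
  unfold dsbs
  split_ifs <;> linarith

theorem dsbsString_nonneg {ρ : ℝ} (h0 : 0 ≤ ρ) (h1 : ρ ≤ 1) {t : ℕ} (r s : BitStr t) :
    0 ≤ dsbsString ρ r s :=
  prod_nonneg fun _ _ => dsbs_nonneg h0 h1 _ _

/-- The pair of correlated strings can itself be the public random string, with each party reading
only its own half. -/
theorem ISRAchievable.publicAchievable {X Y Z : Type} [DecidableEq Z] {M : CommModel} {ρ : ℝ}
    (h0 : 0 ≤ ρ) (h1 : ρ ≤ 1) {f : X → Y → Option Z} {k : ℕ} (h : ISRAchievable M ρ f k) :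
    PublicAchievable M f k := by
  obtain ⟨t, P, hM, hk, hP⟩ := h
  refine ⟨BitStr t × BitStr t, inferInstance, fun ω => dsbsString ρ ω.1 ω.2,
    P.comap (fun v => (v.1, v.2.1)) (fun v => (v.1, v.2.2)),
    ⟨fun ω => dsbsString_nonneg h0 h1 _ _, ?_⟩,
    Protocol.allowed_comap _ _ hM, by rw [Protocol.cost_comap, hk], fun x y z hz => ?_⟩
  · rw [Fintype.sum_prod_type]
    exact sum_dsbsString ρ t
  · rw [Fintype.sum_prod_type]
    simpa only [Protocol.eval_comap] using hP x y z hz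

theorem randCC_le_isrCC {n : ℕ} {Y Z : Type} [DecidableEq Z] [Inhabited Z] (M : CommModel) {ρ : ℝ}
    (h0 : 0 ≤ ρ) (h1 : ρ ≤ 1) (f : BitStr n → Y → Option Z) : randCC M f ≤ isrCC M ρ f :=
  Nat.sInf_le (ISRAchievable.publicAchievable h0 h1 (Nat.sInf_mem (exists_isrAchievable M ρ f)))

theorem publicAchievable_randCC {n : ℕ} {Y Z : Type} [DecidableEq Z] [Inhabited Z] (M : CommModel)
    (f : BitStr n → Y → Option Z) : PublicAchievable M f (randCC M f) :=
  Nat.sInf_mem (exists_publicAchievable M f)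

theorem randCC_twoWay_le_oneWay {n : ℕ} {Y Z : Type} [DecidableEq Z] [Inhabited Z]
    (f : BitStr n → Y → Option Z) : randCC .twoWay f ≤ randCC .oneWay f := by
  obtain ⟨Ω, i, p, P, hp, -, hk, hP⟩ := publicAchievable_randCC .oneWay f
  exact Nat.sInf_le ⟨Ω, i, p, P, hp, trivial, hk, hP⟩

theorem isrCC_twoWay_le_oneWay {n : ℕ} {Y Z : Type} [DecidableEq Z] [Inhabited Z] (ρ : ℝ)
    (f : BitStr n → Y → Option Z) : isrCC .twoWay ρ f ≤ isrCC .oneWay ρ f := by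
  obtain ⟨t, P, -, hk, hP⟩ := Nat.sInf_mem (exists_isrAchievable .oneWay ρ f)
  exact Nat.sInf_le ⟨t, P, trivial, hk, hP⟩

/-! ### Derandomization by averaging -/

/-- Averaging: some value of the public randomness is right on two thirds of any finite family of
inputs. -/
theorem ComputesPublic.exists_card_le {X Y Z Ω ι : Type} [DecidableEq Z] [Fintype Ω] [Fintype ι]
    {p : Ω → ℝ} (hp : p ∈ stdSimplex ℝ Ω) {P : Protocol (X × Ω) (Y × Ω) Z}
    {f : X → Y → Option Z} (hP : ComputesPublic p P f) (x : ι → X) (y : ι → Y) (z : ι → Z)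
    (h : ∀ i, f (x i) (y i) = some (z i)) :
    ∃ ω, 2 / 3 * (Fintype.card ι : ℝ) ≤
      (#{i | P.eval (x i, ω) (y i, ω) = z i} : ℝ) := by
  by_contra! hlt
  have hsum : (2 / 3 * (Fintype.card ι : ℝ)) ≤
      ∑ ω, p ω * (#{i | P.eval (x i, ω) (y i, ω) = z i} : ℝ) := by
    calc (2 / 3 * (Fintype.card ι : ℝ)) = ∑ _i : ι, (2 / 3 : ℝ) := by
          rw [sum_const, card_univ, nsmul_eq_mul, mul_comm]
      _ ≤ ∑ i, ∑ ω, if P.eval (x i, ω) (y i, ω) = z i then p ω else 0 :=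
          sum_le_sum fun i _ => hP _ _ _ (h i)
      _ = _ := by
          rw [sum_comm]
          refine sum_congr rfl fun ω _ => ?_
          rw [← sum_filter, sum_const, nsmul_eq_mul, mul_comm]
  -- A point of positive mass is what makes the averaged inequality strict.
  obtain ⟨ω, hω⟩ : ∃ ω, 0 < p ω := by
    by_contra! h0
    have := sum_nonpos fun ω (_ : ω ∈ (univ : Finset Ω)) => h0 ω
    rw [hp.2] at this
    norm_num at this
  have : ∑ ω, p ω * (#{i | P.eval (x i, ω) (y i, ω) = z i} : ℝ) <
      ∑ ω, p ω * (2 / 3 * (Fintype.card ι : ℝ)) :=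
    sum_lt_sum (fun ω _ => mul_le_mul_of_nonneg_left (hlt ω).le (hp.1 ω))
      ⟨ω, mem_univ _, mul_lt_mul_of_pos_left (hlt ω) hω⟩
  rw [← sum_mul, hp.2, one_mul] at this
  exact absurd hsum (not_le.2 this)

/-- A public-coin protocol yields a deterministic one of the same cost that is right on two thirds
of a given finite family of inputs. -/
theorem PublicAchievable.exists_deterministic {X Y Z U V ι : Type} [DecidableEq Z] [Fintype ι]
    {M : CommModel} {f : X → Y → Option Z} {k : ℕ} (h : PublicAchievable M f k)
    (e : U → X) (e' : V → Y) (u : ι → U) (v : ι → V) (z : ι → Z)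
    (hz : ∀ i, f (e (u i)) (e' (v i)) = some (z i)) :
    ∃ D : Protocol U V Z, D.Allowed M ∧ D.cost = k ∧
      2 / 3 * (Fintype.card ι : ℝ) ≤ (#{i | D.eval (u i) (v i) = z i} : ℝ) := by
  obtain ⟨Ω, _, p, P, hp, hM, hk, hP⟩ := h
  obtain ⟨ω, hω⟩ := hP.exists_card_le hp (fun i => e (u i)) (fun i => e' (v i)) z hz
  refine ⟨P.comap (fun u => (e u, ω)) (fun v => (e' v, ω)), Protocol.allowed_comap _ _ hM,
    by rw [Protocol.cost_comap, hk], ?_⟩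
  simpa only [Protocol.eval_comap] using hω

/-! ### Embedding small problems into set intersection by padding -/

theorem weight_eq_sum {n : ℕ} (x : BitStr n) : weight x = ∑ i, (x i).toNat := by
  rw [weight, card_filter]
  refine sum_congr rfl fun i _ => ?_
  cases x i <;> rfl

theorem weight_extend {n : ℕ} {S : Type} [Fintype S] (ι : S ↪ Fin n) (x : S → Bool) :
    weight (Function.extend ι x fun _ => false) = ∑ s, (x s).toNat := by
  classical
  rw [weight_eq_sum, ← sum_subset (subset_univ (univ.map ι)), sum_map]
  · refine sum_congr rfl fun s _ => ?_
    rw [ι.injective.extend_apply]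
  · intro j _ hj
    rw [Function.extend_apply']
    · rfl
    · rintro ⟨s, rfl⟩
      exact hj (mem_map_of_mem _ (mem_univ s))

theorem bitAnd_extend {n : ℕ} {S : Type} (ι : S ↪ Fin n) (x y : S → Bool) :
    bitAnd (Function.extend ι x fun _ => false) (Function.extend ι y fun _ => false) =
      Function.extend ι (fun s => x s && y s) fun _ => false := by
  funext j
  by_cases h : ∃ s, ι s = j
  · obtain ⟨s, rfl⟩ := h
    simp only [bitAnd, ι.injective.extend_apply]
  · simp only [bitAnd, Function.extend_apply' _ _ _ h, Bool.and_self]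

theorem sum_toNat_decide_lt {p q : ℕ} (h : q ≤ p) :
    ∑ i : Fin p, (decide ((i : ℕ) < q)).toNat = q := by
  rw [Fin.sum_univ_eq_sum_range (fun i => (decide (i < q)).toNat) p]
  have : ∀ i, (decide (i < q)).toNat = if i < q then 1 else 0 := fun i => by
    by_cases hi : i < q <;> simp [hi]
  simp only [this]
  rw [← card_filter]
  have : (range p).filter (· < q) = range q := by
    ext i
    simp only [mem_filter, mem_range]
    omega
  rw [this, card_range]

/-- Strings of bounded weight embed into strings of weights exactly `a` and `b`, by private and
common padding, so that the intersection sizes are shifted by a constant. -/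
theorem exists_ssi_encoding {n a b m α β : ℕ} (hα : α ≤ a) (hβ : β ≤ b)
    (hn : m + α + β + max (a - α) (b - β) ≤ n) :
    ∃ e e' : BitStr m → BitStr n, ∀ u v, weight u ≤ α → weight v ≤ β →
      ssi n a b (e u) (e' v) =
        some ((weight (bitAnd u v) : ℤ) + (min (a - α) (b - β) : ℕ)) := by
  -- The four blocks hold the data, Alice's private padding up to weight `α`, Bob's private padding
  -- up to weight `β`, and a common zone. In the common zone each party fills an initial segment, so
  -- the overlap is the shorter segment whatever the data.
  obtain ⟨ι⟩ : Nonempty (Fin m ⊕ Fin α ⊕ Fin β ⊕ Fin (max (a - α) (b - β)) ↪ Fin n) := by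
    apply Function.Embedding.nonempty_of_card_le
    simp only [Fintype.card_sum, Fintype.card_fin]
    omega
  let x : BitStr m → (Fin m ⊕ Fin α ⊕ Fin β ⊕ Fin (max (a - α) (b - β))) → Bool := fun u =>
    Sum.elim u (Sum.elim (fun i => decide ((i : ℕ) < α - weight u))
      (Sum.elim (fun _ => false) fun i => decide ((i : ℕ) < a - α)))
  let y : BitStr m → (Fin m ⊕ Fin α ⊕ Fin β ⊕ Fin (max (a - α) (b - β))) → Bool := fun v =>
    Sum.elim v (Sum.elim (fun _ => false)
      (Sum.elim (fun i => decide ((i : ℕ) < β - weight v)) fun i => decide ((i : ℕ) < b - β)))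
  refine ⟨fun u => Function.extend ι (x u) fun _ => false,
    fun v => Function.extend ι (y v) fun _ => false, fun u v hu hv => ?_⟩
  have h1 : weight (Function.extend ι (x u) fun _ => false) = a := by
    rw [weight_extend]
    simp only [x, Fintype.sum_sum_type, Sum.elim_inl, Sum.elim_inr, Bool.toNat_false,
      sum_const_zero]
    rw [← weight_eq_sum u, sum_toNat_decide_lt (Nat.sub_le _ _),
      sum_toNat_decide_lt (le_max_left _ _)]
    omega
  have h2 : weight (Function.extend ι (y v) fun _ => false) = b := by
    rw [weight_extend]
    simp only [y, Fintype.sum_sum_type, Sum.elim_inl, Sum.elim_inr, Bool.toNat_false,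
      sum_const_zero]
    rw [← weight_eq_sum v, sum_toNat_decide_lt (Nat.sub_le _ _),
      sum_toNat_decide_lt (le_max_right _ _)]
    omega
  have h3 : weight (bitAnd (Function.extend ι (x u) fun _ => false)
      (Function.extend ι (y v) fun _ => false)) =
      weight (bitAnd u v) + min (a - α) (b - β) := by
    rw [bitAnd_extend, weight_extend]
    simp only [x, y, Fintype.sum_sum_type, Sum.elim_inl, Sum.elim_inr, Bool.and_false,
      Bool.false_and, Bool.toNat_false, sum_const_zero, zero_add]
    rw [weight_eq_sum (bitAnd u v)]
    congr 1
    rw [← sum_toNat_decide_lt (min_le_max : min (a - α) (b - β) ≤ max (a - α) (b - β))]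
    refine sum_congr rfl fun i _ => ?_
    rw [← Bool.decide_and]
    simp only [lt_min_iff]
  simp only [ssi]
  rw [if_pos ⟨h1, h2⟩, h3]
  push_cast
  rfl

/-- Two inputs of each party such that neither input alone determines the answer. -/
theorem exists_ssi_undetermined {n a b : ℕ} (ha : 1 ≤ a) (hb : 1 ≤ b) (han : 2 * a ≤ n)
    (hbn : 2 * b ≤ n) :
    ∃ e e' : Bool → BitStr n, ∃ K : ℤ, ∀ c d,
      ssi n a b (e c) (e' d) = some (if c = d then K + 1 else K) := by
  obtain ⟨ι⟩ : Nonempty (Bool ⊕ Fin (max (a - 1) (b - 1)) ↪ Fin n) := by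
    apply Function.Embedding.nonempty_of_card_le
    simp only [Fintype.card_sum, Fintype.card_fin, Fintype.card_bool]
    omega
  let x : ℕ → Bool → (Bool ⊕ Fin (max (a - 1) (b - 1))) → Bool := fun q c =>
    Sum.elim (fun d => decide (c = d)) fun i => decide ((i : ℕ) < q - 1)
  have hw : ∀ q c, 1 ≤ q → q - 1 ≤ max (a - 1) (b - 1) →
      weight (Function.extend ι (x q c) fun _ => false) = q := by
    intro q c h1 h2
    rw [weight_extend]
    simp only [x, Fintype.sum_sum_type, Sum.elim_inl, Sum.elim_inr]
    rw [sum_toNat_decide_lt h2]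
    cases c <;> simp <;> omega
  refine ⟨fun c => Function.extend ι (x a c) fun _ => false,
    fun c => Function.extend ι (x b c) fun _ => false, (min (a - 1) (b - 1) : ℕ), fun c d => ?_⟩
  have h3 : weight (bitAnd (Function.extend ι (x a c) fun _ => false)
      (Function.extend ι (x b d) fun _ => false)) =
      (if c = d then 1 else 0) + min (a - 1) (b - 1) := by
    rw [bitAnd_extend, weight_extend]
    simp only [x, Fintype.sum_sum_type, Sum.elim_inl, Sum.elim_inr]
    congr 1
    · cases c <;> cases d <;> simp
    · rw [← sum_toNat_decide_lt (min_le_max : min (a - 1) (b - 1) ≤ max (a - 1) (b - 1))]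
      refine sum_congr rfl fun i _ => ?_
      rw [← Bool.decide_and]
      simp only [lt_min_iff]
  simp only [ssi]
  rw [if_pos ⟨hw _ _ ha (le_max_left _ _), hw _ _ hb (le_max_right _ _)⟩, h3]
  split_ifs <;> push_cast <;> simp [add_comm]

/-- Without communication the output depends on one party's input only. Fixing that input and
varying the other between two values with different answers leaves at most one of two inputs right,
which is less than two thirds. The bound lets later estimates absorb additive constants into
multiples of the cost. -/
theorem one_le_randCC_ssi {n a b : ℕ} (M : CommModel) (ha : 1 ≤ a) (hb : 1 ≤ b)
    (han : 2 * a ≤ n) (hbn : 2 * b ≤ n) : 1 ≤ randCC M (ssi n a b) := by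
  by_contra! hlt
  obtain ⟨Ω, _, p, P, hp, -, hk, hP⟩ := publicAchievable_randCC M (ssi n a b)
  obtain ⟨e, e', K, he⟩ := exists_ssi_undetermined ha hb han hbn
  have key : ∀ (o z : Bool → ℤ), o true = o false → z true ≠ z false →
      ¬ (2 / 3 * (Fintype.card Bool : ℝ) ≤ (#{i | o i = z i} : ℝ)) := by
    intro o z ho hz hle
    have : #{i | o i = z i} ≤ 1 := by
      refine card_le_one.2 fun c hc d hd => ?_
      rw [mem_filter] at hc hd
      replace hc := hc.2
      replace hd := hd.2
      cases c <;> cases d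
      · rfl
      · exact absurd (hd.symm.trans (ho.trans hc)) hz
      · exact absurd (hc.symm.trans (ho.trans hd)) hz
      · rfl
    have : (#{i | o i = z i} : ℝ) ≤ 1 := by exact_mod_cast this
    rw [Fintype.card_bool] at hle
    push_cast at hle
    linarith
  cases P with
  | aliceOutputs out =>
    obtain ⟨ω, hω⟩ := hP.exists_card_le hp (fun _ : Bool => e true) e' _ fun d => he true d
    exact key (fun _ => out (e true, ω)) _ rfl (by simp) hω
  | bobOutputs out =>
    obtain ⟨ω, hω⟩ := hP.exists_card_le hp e (fun _ : Bool => e' true) _ fun c => he c true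
    exact key (fun _ => out (e' true, ω)) _ rfl (by simp) hω
  | aliceSends bit next => simp only [Protocol.cost] at hk; omega
  | bobSends bit next => simp only [Protocol.cost] at hk; omega

/-! ### Guessing the bits of a random string -/

/-- The character `±1` of a bit. -/
def bitSign (c : Bool) : ℝ := if c then -1 else 1

theorem bitSign_mul_bitSign (c d : Bool) : bitSign c * bitSign d = if c = d then 1 else -1 := by
  cases c <;> cases d <;> simp [bitSign]

theorem sum_bitSign_mul_bitSign {ι : Type} [Fintype ι] (p q : ι → Bool) :
    ∑ i, bitSign (p i) * bitSign (q i) =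
      2 * (#{i | p i = q i} : ℝ) - Fintype.card ι := by
  have h : ∀ i, bitSign (p i) * bitSign (q i) = 2 * (if p i = q i then 1 else 0) - 1 := fun i => by
    rw [bitSign_mul_bitSign]
    split_ifs <;> norm_num
  simp only [h, sum_sub_distrib, ← mul_sum, sum_boole, sum_const, card_univ, nsmul_eq_mul, mul_one]

theorem sum_exp_bitSign {m : ℕ} (l : ℝ) (g : BitStr m) :
    ∑ u : BitStr m, Real.exp (l * ∑ i, bitSign (g i) * bitSign (u i)) =
      2 ^ m * Real.cosh l ^ m := by
  have h1 : ∀ u : BitStr m, Real.exp (l * ∑ i, bitSign (g i) * bitSign (u i)) =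
      ∏ i, Real.exp (l * (bitSign (g i) * bitSign (u i))) := fun u => by
    rw [mul_sum, Real.exp_sum]
  have h2 : ∀ c, ∑ d, Real.exp (l * (bitSign c * bitSign d)) = 2 * Real.cosh l := by
    intro c
    rw [Real.cosh_eq]
    cases c <;> simp [bitSign] <;> ring
  simp only [h1]
  rw [← Fintype.prod_sum fun i d => Real.exp (l * (bitSign (g i) * bitSign d))]
  simp only [h2, prod_const, card_univ, Fintype.card_fin, mul_pow]

/-- Guessing the bits of a uniformly random string of length `m` with advantage, given a message
from `J`, needs exponentially many messages. -/
theorem div_le_log_card_of_guess {m : ℕ} {J : Type} [Fintype J] (g : J → BitStr m)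
    (sel : BitStr m → J)
    (h : 2 / 3 * (Fintype.card (BitStr m × Fin m) : ℝ) ≤
      (#{q : BitStr m × Fin m | g (sel q.1) q.2 = q.1 q.2} : ℝ)) :
    (m : ℝ) / 18 ≤ Real.log (Fintype.card J) := by
  have hcard : (Fintype.card (BitStr m × Fin m) : ℝ) = 2 ^ m * m := by
    simp
  set corr : BitStr m → ℝ := fun u => ∑ i, bitSign (g (sel u) i) * bitSign (u i)
  have hcorr : 2 ^ m * (m / 3 : ℝ) ≤ ∑ u, corr u := by
    have : ∑ u, corr u =
        ∑ q : BitStr m × Fin m, bitSign (g (sel q.1) q.2) * bitSign (q.1 q.2) := by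
      rw [Fintype.sum_prod_type]
    rw [this, sum_bitSign_mul_bitSign (fun q : BitStr m × Fin m => g (sel q.1) q.2)
      fun q => q.1 q.2]
    rw [hcard] at h ⊢
    linarith
  -- Jensen's inequality, by means of the tangent to `exp` at `m / 9`. The parameter `l = 1 / 3`
  -- maximizes `l * m / 3 - l ^ 2 * m / 2`, the gap between the exponents of the lower and upper
  -- estimates.
  have hlow : 2 ^ m * Real.exp (m / 9) ≤ ∑ u, Real.exp (1 / 3 * corr u) := by
    have htan : ∀ u, Real.exp (m / 9) * (1 + (1 / 3 * corr u - m / 9)) ≤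
        Real.exp (1 / 3 * corr u) := fun u => by
      have : Real.exp (1 / 3 * corr u) =
          Real.exp (m / 9) * Real.exp (1 / 3 * corr u - m / 9) := by
        rw [← Real.exp_add]
        ring_nf
      rw [this]
      refine mul_le_mul_of_nonneg_left ?_ (Real.exp_pos _).le
      linarith [Real.add_one_le_exp (1 / 3 * corr u - m / 9)]
    refine le_trans ?_ (sum_le_sum fun u _ => htan u)
    rw [← mul_sum, mul_comm]
    refine mul_le_mul_of_nonneg_left ?_ (Real.exp_pos _).le
    rw [sum_add_distrib, sum_sub_distrib, ← mul_sum]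
    simp only [sum_const, card_univ, Fintype.card_fun, Fintype.card_bool, Fintype.card_fin,
      nsmul_eq_mul]
    push_cast
    linarith
  -- Replacing the term of the selected guess by the sum over all guesses removes the dependence on
  -- `u`; each fixed guess then has an exactly computable exponential moment.
  have hup : ∑ u, Real.exp (1 / 3 * corr u) ≤
      Fintype.card J * (2 ^ m * Real.cosh (1 / 3) ^ m) := by
    calc ∑ u, Real.exp (1 / 3 * corr u)
        ≤ ∑ u : BitStr m, ∑ j, Real.exp (1 / 3 * ∑ i, bitSign (g j i) * bitSign (u i)) :=
          sum_le_sum fun u _ => single_le_sum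
            (f := fun j => Real.exp (1 / 3 * ∑ i, bitSign (g j i) * bitSign (u i)))
            (fun j _ => (Real.exp_pos _).le) (mem_univ (sel u))
      _ = _ := by
          rw [sum_comm]
          simp only [sum_exp_bitSign, sum_const, card_univ, nsmul_eq_mul]
  have hcosh : Real.cosh (1 / 3) ^ m ≤ Real.exp (m / 18) := by
    calc Real.cosh (1 / 3) ^ m ≤ Real.exp ((1 / 3) ^ 2 / 2) ^ m :=
          pow_le_pow_left₀ (Real.cosh_pos _).le (Real.cosh_le_exp_half_sq _) _
      _ = Real.exp (m / 18) := by
          rw [← Real.exp_nat_mul]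
          ring_nf
  have hJ : Real.exp (m / 18) ≤ Fintype.card J := by
    have h1 : 2 ^ m * Real.exp (m / 9) ≤ 2 ^ m * (Fintype.card J * Real.exp (m / 18)) := by
      refine (hlow.trans hup).trans ?_
      rw [mul_left_comm]
      gcongr
    have h2 := le_of_mul_le_mul_left h1 (by positivity)
    have h3 : Real.exp (m / 9) = Real.exp (m / 18) * Real.exp (m / 18) := by
      rw [← Real.exp_add]
      ring_nf
    rw [h3] at h2
    exact le_of_mul_le_mul_right h2 (Real.exp_pos _)
  rw [Real.le_log_iff_exp_le ((Real.exp_pos _).trans_le hJ)]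
  exact hJ

/-! ### Counting messages and strategies -/

namespace Protocol

variable {A B Z : Type}

/-- In a one-way protocol Bob sees one of at most `2 ^ cost` messages. -/
theorem IsOneWay.exists_messages {P : Protocol A B Z} (h : P.IsOneWay) :
    ∃ (J : Type) (_ : Fintype J) (sel : A → J) (g : J → B → Z),
      Fintype.card J ≤ 2 ^ P.cost ∧ ∀ α β, P.eval α β = g (sel α) β := by
  induction P with
  | aliceOutputs out => exact h.elim
  | bobOutputs out =>
    exact ⟨Unit, inferInstance, fun _ => (), fun _ => out, by simp [cost], fun _ _ => rfl⟩
  | bobSends bit next ih => exact h.elim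
  | aliceSends bit next ih =>
    choose J hJ sel g hc he using fun c => ih c (h c)
    refine ⟨J false ⊕ J true, inferInstance,
      fun α => if bit α then Sum.inr (sel true α) else Sum.inl (sel false α),
      Sum.elim (g false) (g true), ?_, fun α β => ?_⟩
    · rw [Fintype.card_sum, cost, pow_succ, mul_two]
      exact add_le_add
        ((hc false).trans (Nat.pow_le_pow_right two_pos (le_max_left _ _)))
        ((hc true).trans (Nat.pow_le_pow_right two_pos (le_max_right _ _)))
    · simp only [eval]
      rw [he]
      cases bit α <;> rfl

/-- Bob's strategy in a two-way protocol is one of a doubly exponential number, as far as a yes/no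
question about the output is concerned. -/
theorem exists_strategies (P : Protocol A B Z) (τ : Z → Bool) :
    ∃ (J : Type) (_ : Fintype J) (sel : B → J) (g : J → A → Bool),
      Fintype.card J ≤ 2 ^ 2 ^ (P.cost + 1) ∧ ∀ α β, τ (P.eval α β) = g (sel β) α := by
  have hmono : ∀ {k K : ℕ}, k ≤ K → 2 ^ 2 ^ (k + 1) ≤ 2 ^ 2 ^ (K + 1) := fun h =>
    Nat.pow_le_pow_right two_pos (Nat.pow_le_pow_right two_pos (Nat.succ_le_succ h))
  induction P with
  | aliceOutputs out =>
    exact ⟨Unit, inferInstance, fun _ => (), fun _ α => τ (out α), by simp [cost], fun _ _ => rfl⟩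
  | bobOutputs out =>
    exact ⟨Bool, inferInstance, fun β => τ (out β), fun c _ => c, by simp [cost], fun _ _ => rfl⟩
  | aliceSends bit next ih =>
    choose J hJ sel g hc he using ih
    -- Bob must be prepared for either bit from Alice, so the strategy counts multiply. This
    -- squaring at each round is the source of the double exponential.
    refine ⟨J false × J true, inferInstance, fun β => (sel false β, sel true β),
      fun j α => if bit α then g true j.2 α else g false j.1 α, ?_, fun α β => ?_⟩
    · rw [Fintype.card_prod, cost, pow_succ 2 (_ + 1), pow_mul, sq]
      exact Nat.mul_le_mul
        ((hc false).trans (hmono (le_max_left _ _))) ((hc true).trans (hmono (le_max_right _ _)))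
    · simp only [eval]
      rw [he]
      cases bit α <;> rfl
  | bobSends bit next ih =>
    choose J hJ sel g hc he using ih
    refine ⟨J false ⊕ J true, inferInstance,
      fun β => if bit β then Sum.inr (sel true β) else Sum.inl (sel false β),
      Sum.elim (g false) (g true), ?_, fun α β => ?_⟩
    · rw [Fintype.card_sum, cost, pow_succ 2 (_ + 1), pow_mul, sq]
      -- Where Bob speaks the counts only add, and `2 * N ≤ N ^ 2` fits the sum under the same
      -- bound.
      refine (add_le_add
        ((hc false).trans (hmono (le_max_left _ (next true).cost)))
        ((hc true).trans (hmono (le_max_right (next false).cost _)))).trans ?_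
      rw [← two_mul]
      exact Nat.mul_le_mul_right _ (Nat.le_self_pow (by positivity) 2)
    · simp only [eval]
      rw [he]
      cases bit β <;> rfl

end Protocol

/-! ### Lower bounds from the index problem -/

/-- The standard basis string. -/
def basisStr {m : ℕ} (i : Fin m) : BitStr m := fun j => decide (j = i)

theorem weight_basisStr {m : ℕ} (i : Fin m) : weight (basisStr i) = 1 := by
  simp only [weight, basisStr, decide_eq_true_eq, filter_eq', mem_univ, if_true, card_singleton]

theorem weight_le {m : ℕ} (u : BitStr m) : weight u ≤ m := by
  simpa [weight] using card_filter_le (univ : Finset (Fin m)) fun i => u i = true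

theorem bitAnd_comm {m : ℕ} (u v : BitStr m) : bitAnd u v = bitAnd v u :=
  funext fun _ => Bool.and_comm _ _

theorem weight_bitAnd_basisStr {m : ℕ} (u : BitStr m) (i : Fin m) :
    weight (bitAnd u (basisStr i)) = (u i).toNat := by
  rw [weight_eq_sum, sum_eq_single i]
  · simp [bitAnd, basisStr]
  · intro j _ hj
    simp [bitAnd, basisStr, hj]
  · simp

theorem decide_toNat_add_eq (c : Bool) (K : ℤ) : decide ((c.toNat : ℤ) + K = K + 1) = c := by
  cases c <;> simp [add_comm]

/-- Intersecting Alice's string with a basis string of Bob reads off one bit. With `m = a / 2`, the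
guessing bound gives `m ≤ 18 * k`, hence `a ≤ 36 * k + 1 ≤ 37 * k`. -/
theorem le_mul_randCC_oneWay_ssi {n a b : ℕ} (hb : 1 ≤ b) (hba : b ≤ a) (han : 2 * a ≤ n) :
    (a : ℝ) ≤ 37 * (randCC .oneWay (ssi n a b) : ℝ) := by
  set k := randCC .oneWay (ssi n a b) with hk
  have hk1 : (1 : ℝ) ≤ k := by
    exact_mod_cast one_le_randCC_ssi .oneWay (hb.trans hba) hb han (by omega)
  rcases Nat.lt_or_ge a 2 with ha | ha
  · have : (a : ℝ) ≤ 1 := by exact_mod_cast Nat.le_of_lt_succ ha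
    linarith
  obtain ⟨e, e', he⟩ := exists_ssi_encoding (n := n) (m := a / 2) (α := a / 2) (β := 1)
    (Nat.div_le_self a 2) hb (by omega)
  set K : ℤ := ((min (a - a / 2) (b - 1) : ℕ) : ℤ)
  obtain ⟨D, hD, hcost, hcard⟩ :=
    (publicAchievable_randCC .oneWay (ssi n a b)).exists_deterministic e (fun i => e' (basisStr i))
      (fun q : BitStr (a / 2) × Fin (a / 2) => q.1) (fun q => q.2)
      (fun q => ((q.1 q.2).toNat : ℤ) + K) fun q => by
        rw [he _ _ (weight_le _) (weight_basisStr _).le, weight_bitAnd_basisStr]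
  obtain ⟨J, _, sel, g, hJ, hg⟩ := Protocol.IsOneWay.exists_messages hD
  have hlog := div_le_log_card_of_guess (fun j i => decide (g j i = K + 1)) sel
    (hcard.trans (by
      refine Nat.cast_le.2 (card_le_card fun q => ?_)
      simp only [mem_filter, mem_univ, true_and]
      intro hq
      rw [← hg, hq, decide_toNat_add_eq]))
  rw [hcost, ← hk] at hJ
  have hpos : 0 < Fintype.card J := Fintype.card_pos_iff.2 ⟨sel fun _ => false⟩
  have hJ' : Real.log (Fintype.card J) ≤ k := by
    calc Real.log (Fintype.card J) ≤ Real.log (2 ^ k) :=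
          Real.log_le_log (by exact_mod_cast hpos) (by exact_mod_cast hJ)
      _ = k * Real.log 2 := Real.log_pow _ _
      _ ≤ k * 1 := mul_le_mul_of_nonneg_left (by linarith [Real.log_two_lt_d9]) (Nat.cast_nonneg _)
      _ = k := mul_one _
  have hm : (a : ℝ) ≤ 2 * ((a / 2 : ℕ) : ℝ) + 1 := by
    exact_mod_cast (by omega : a ≤ 2 * (a / 2) + 1)
  linarith

/-- The index problem with the roles exchanged: Bob's strategy plays the part of the message. Since
the number of strategies is doubly exponential in the cost, `b` is bounded by a single exponential.
-/
theorem logb_le_mul_randCC_twoWay_ssi {n a b : ℕ} (ha : 1 ≤ a) (hab : a ≤ b) (hbn : 2 * b ≤ n) :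
    Real.logb 2 b ≤ 8 * (randCC .twoWay (ssi n a b) : ℝ) := by
  set k := randCC .twoWay (ssi n a b) with hk
  have hk1 : (1 : ℝ) ≤ k := by
    exact_mod_cast one_le_randCC_ssi .twoWay ha (ha.trans hab) (by omega) hbn
  rcases Nat.lt_or_ge b 2 with hb | hb
  · obtain rfl : b = 1 := by omega
    simp only [Nat.cast_one, Real.logb_one]
    positivity
  obtain ⟨e, e', he⟩ := exists_ssi_encoding (n := n) (m := b / 2) (α := 1) (β := b / 2)
    ha (Nat.div_le_self b 2) (by omega)
  set K : ℤ := ((min (a - 1) (b - b / 2) : ℕ) : ℤ)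
  obtain ⟨D, -, hcost, hcard⟩ :=
    (publicAchievable_randCC .twoWay (ssi n a b)).exists_deterministic (fun i => e (basisStr i)) e'
      (fun q : BitStr (b / 2) × Fin (b / 2) => q.2) (fun q => q.1)
      (fun q => ((q.1 q.2).toNat : ℤ) + K) fun q => by
        rw [he _ _ (weight_basisStr _).le (weight_le _), bitAnd_comm, weight_bitAnd_basisStr]
  obtain ⟨J, _, sel, g, hJ, hg⟩ := D.exists_strategies fun z => decide (z = K + 1)
  have hlog := div_le_log_card_of_guess g sel
    (hcard.trans (by
      refine Nat.cast_le.2 (card_le_card fun q => ?_)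
      simp only [mem_filter, mem_univ, true_and]
      intro hq
      rw [← hg, hq, decide_toNat_add_eq]))
  rw [hcost, ← hk] at hJ
  have hpos : 0 < Fintype.card J := Fintype.card_pos_iff.2 ⟨sel fun _ => false⟩
  have hJ' : Real.log (Fintype.card J) ≤ 2 ^ (k + 1) := by
    calc Real.log (Fintype.card J) ≤ Real.log (2 ^ 2 ^ (k + 1)) :=
          Real.log_le_log (by exact_mod_cast hpos) (by exact_mod_cast hJ)
      _ = 2 ^ (k + 1) * Real.log 2 := by rw [Real.log_pow]; push_cast; rfl
      _ ≤ 2 ^ (k + 1) * 1 :=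
          mul_le_mul_of_nonneg_left (by linarith [Real.log_two_lt_d9]) (by positivity)
      _ = 2 ^ (k + 1) := mul_one _
  have hm : (b : ℝ) ≤ 3 * ((b / 2 : ℕ) : ℝ) := by
    exact_mod_cast (by omega : b ≤ 3 * (b / 2))
  -- Here `b ≤ 3 * 18 * 2 ^ (k + 1)`, and `54` is rounded up to `64`.
  have hbpow : (b : ℝ) ≤ 2 ^ (k + 7) := by
    have : (2 : ℝ) ^ (k + 7) = 64 * 2 ^ (k + 1) := by ring
    have : (0 : ℝ) < 2 ^ (k + 1) := by positivity
    linarith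
  have hb0 : (0 : ℝ) < b := by exact_mod_cast (by omega : 0 < b)
  have := Real.logb_le_logb_of_le one_lt_two hb0 hbpow
  rw [Real.logb_pow, Real.logb_self_eq_one one_lt_two, mul_one] at this
  push_cast at this
  linarith

/-! ### Lower bound from the discrepancy of the inner product -/

/-- The inner product character `(-1) ^ |u ∧ v|`. -/
def ipSign {m : ℕ} (u v : BitStr m) : ℝ := ∏ i, bitSign (u i && v i)

theorem ipSign_eq {m : ℕ} (u v : BitStr m) : ipSign u v = (-1) ^ weight (bitAnd u v) := by
  rw [weight_eq_sum, ← prod_pow_eq_pow_sum]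
  refine prod_congr rfl fun i _ => ?_
  simp only [bitAnd]
  cases u i && v i <;> simp [bitSign]

theorem sum_ipSign_mul_ipSign {m : ℕ} (v w : BitStr m) :
    ∑ u, ipSign u v * ipSign u w = if v = w then 2 ^ m else 0 := by
  have h : ∀ c d, ∑ x, bitSign (x && c) * bitSign (x && d) = if c = d then 2 else 0 := by
    intro c d
    cases c <;> cases d <;> norm_num [bitSign]
  simp only [ipSign, ← prod_mul_distrib]
  rw [← Fintype.prod_sum fun i x => bitSign (x && v i) * bitSign (x && w i)]
  simp only [h]
  split_ifs with hvw
  · simp [hvw]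
  · obtain ⟨i, hi⟩ := Function.ne_iff.1 hvw
    exact prod_eq_zero (mem_univ i) (if_neg hi)

/-- Lindsey lemma: the inner product matrix has small discrepancy. -/
theorem sq_sum_ipSign_le {m : ℕ} (f g : BitStr m → ℝ) (hf : ∀ u, |f u| ≤ 1)
    (hg : ∀ v, |g v| ≤ 1) :
    (∑ u, ∑ v, f u * g v * ipSign u v) ^ 2 ≤ 8 ^ m := by
  have hsum : ∀ h : BitStr m → ℝ, (∀ u, |h u| ≤ 1) → ∑ u, h u ^ 2 ≤ 2 ^ m := by
    intro h hh
    calc ∑ u, h u ^ 2 ≤ ∑ _u : BitStr m, (1 : ℝ) :=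
          sum_le_sum fun u _ => (sq_le_one_iff_abs_le_one _).2 (hh u)
      _ = 2 ^ m := by simp
  have hcs := sum_mul_sq_le_sq_mul_sq univ f fun u => ∑ v, g v * ipSign u v
  -- Parseval: the columns of the sign matrix are orthogonal with square norm `2 ^ m`.
  have hsq : ∑ u, (∑ v, g v * ipSign u v) ^ 2 = 2 ^ m * ∑ v, g v ^ 2 := by
    calc ∑ u, (∑ v, g v * ipSign u v) ^ 2
        = ∑ u, ∑ v, ∑ w, g v * g w * (ipSign u v * ipSign u w) := by
          refine sum_congr rfl fun u _ => ?_
          rw [sq, sum_mul_sum]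
          refine sum_congr rfl fun v _ => sum_congr rfl fun w _ => by ring
      _ = ∑ v, ∑ w, g v * g w * ∑ u, ipSign u v * ipSign u w := by
          rw [sum_comm]
          refine sum_congr rfl fun v _ => ?_
          rw [sum_comm]
          refine sum_congr rfl fun w _ => (mul_sum _ _ _).symm
      _ = 2 ^ m * ∑ v, g v ^ 2 := by
          simp only [sum_ipSign_mul_ipSign, mul_ite, mul_zero, sum_ite_eq, mem_univ, if_true,
            mul_sum]
          refine sum_congr rfl fun v _ => by ring
  calc (∑ u, ∑ v, f u * g v * ipSign u v) ^ 2
      = (∑ u, f u * ∑ v, g v * ipSign u v) ^ 2 := by simp only [mul_sum, mul_assoc]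
    _ ≤ (∑ u, f u ^ 2) * (2 ^ m * ∑ v, g v ^ 2) := by rw [← hsq]; exact hcs
    _ ≤ 2 ^ m * (2 ^ m * 2 ^ m) := by
        gcongr
        · exact hsum f hf
        · exact hsum g hg
    _ = 8 ^ m := by
        rw [← mul_pow, ← mul_pow]
        norm_num

/-- Protocols of small cost have small correlation with the inner product. -/
theorem Protocol.abs_sum_ipSign_le {m : ℕ} {Z : Type} (P : Protocol (BitStr m) (BitStr m) Z)
    (σ : Z → ℝ) (hσ : ∀ z, |σ z| ≤ 1) (f g : BitStr m → ℝ) (hf : ∀ u, |f u| ≤ 1)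
    (hg : ∀ v, |g v| ≤ 1) :
    |∑ u, ∑ v, f u * g v * (ipSign u v * σ (P.eval u v))| ≤ 2 ^ P.cost * √(8 ^ m) := by
  have hmul : ∀ x y : ℝ, |x| ≤ 1 → |y| ≤ 1 → |x * y| ≤ 1 := fun x y hx hy => by
    rw [abs_mul]
    exact mul_le_one₀ hx (abs_nonneg _) hy
  have hind : ∀ (p : BitStr m → Bool) (c : Bool) u, |if p u = c then (1 : ℝ) else 0| ≤ 1 := by
    intro p c u
    split_ifs <;> simp
  have hadd : ∀ {x y : ℝ} {k l : ℕ}, |x| ≤ 2 ^ k * √(8 ^ m) → |y| ≤ 2 ^ l * √(8 ^ m) →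
      |x + y| ≤ 2 ^ (max k l + 1) * √(8 ^ m) := by
    intro x y k l hx hy
    have h1 : (2 : ℝ) ^ k ≤ 2 ^ max k l := pow_le_pow_right₀ one_le_two (le_max_left _ _)
    have h2 : (2 : ℝ) ^ l ≤ 2 ^ max k l := pow_le_pow_right₀ one_le_two (le_max_right _ _)
    have h3 : (2 : ℝ) ^ (max k l + 1) = 2 ^ max k l + 2 ^ max k l := by ring
    rw [h3, add_mul]
    exact (abs_add_le _ _).trans (add_le_add
      (hx.trans (mul_le_mul_of_nonneg_right h1 (Real.sqrt_nonneg _)))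
      (hy.trans (mul_le_mul_of_nonneg_right h2 (Real.sqrt_nonneg _))))
  -- The weights `f` and `g` accumulate the indicators of the rectangle reached so far. At a leaf
  -- the sign of the output depends on one party's input, so it is absorbed into that party's weight
  -- and the Lindsey bound applies; the leaves contribute the factor `2 ^ P.cost`.
  induction P generalizing f g with
  | aliceOutputs out =>
    simp only [eval, cost, pow_zero, one_mul]
    refine Real.abs_le_sqrt (le_of_eq_of_le ?_
      (sq_sum_ipSign_le (fun u => f u * σ (out u)) g (fun u => hmul _ _ (hf u) (hσ _)) hg))
    congr 1
    exact sum_congr rfl fun u _ => sum_congr rfl fun v _ => by ring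
  | bobOutputs out =>
    simp only [eval, cost, pow_zero, one_mul]
    refine Real.abs_le_sqrt (le_of_eq_of_le ?_
      (sq_sum_ipSign_le f (fun v => g v * σ (out v)) hf fun v => hmul _ _ (hg v) (hσ _)))
    congr 1
    exact sum_congr rfl fun u _ => sum_congr rfl fun v _ => by ring
  | aliceSends bit next ih =>
    have h := fun c => ih c (fun u => f u * if bit u = c then 1 else 0) g
      (fun u => hmul _ _ (hf u) (hind bit c u)) hg
    refine le_of_eq_of_le (congrArg _ ?_) (hadd (h false) (h true))
    simp only [← sum_add_distrib]
    refine sum_congr rfl fun u _ => sum_congr rfl fun v _ => ?_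
    simp only [eval]
    cases bit u <;> simp
  | bobSends bit next ih =>
    have h := fun c => ih c f (fun v => g v * if bit v = c then 1 else 0) hf
      (fun v => hmul _ _ (hg v) (hind bit c v))
    refine le_of_eq_of_le (congrArg _ ?_) (hadd (h false) (h true))
    simp only [← sum_add_distrib]
    refine sum_congr rfl fun u _ => sum_congr rfl fun v _ => ?_
    simp only [eval]
    cases bit v <;> simp

/-- Success on two thirds of the pairs forces correlation at least `4 ^ m / 3` with the parity of
the intersection, against the upper bound `2 ^ k * √(8 ^ m)`. Hence `m ≤ 2 * k + 4` for `m = a / 2`,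
and `a ≤ 4 * k + 9 ≤ 13 * k`. -/
theorem le_mul_randCC_twoWay_ssi {n a b : ℕ} (ha : 1 ≤ a) (hab : a ≤ b) (hbn : 2 * b ≤ n) :
    (a : ℝ) ≤ 13 * (randCC .twoWay (ssi n a b) : ℝ) := by
  set k := randCC .twoWay (ssi n a b) with hk
  have hk1 : 1 ≤ k := one_le_randCC_ssi .twoWay ha (ha.trans hab) (by omega) hbn
  set m := a / 2 with hm
  obtain ⟨e, e', he⟩ := exists_ssi_encoding (n := n) (a := a) (b := b) (m := m) (α := m) (β := m)
    (by omega) (by omega) (by omega)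
  set K : ℕ := min (a - m) (b - m)
  obtain ⟨D, -, hcost, hcard⟩ :=
    (publicAchievable_randCC .twoWay (ssi n a b)).exists_deterministic e e'
      (fun q : BitStr m × BitStr m => q.1) (fun q => q.2)
      (fun q => (weight (bitAnd q.1 q.2) : ℤ) + K) fun q => he _ _ (weight_le _) (weight_le _)
  -- The parity of the output with the padding's contribution `K` removed. It is a sign for every
  -- integer, so a wrong output costs at most `-1`.
  let σ : ℤ → ℝ := fun z => (-1) ^ (z - K).natAbs
  have hσ : ∀ z, |σ z| ≤ 1 := fun z => by simp [σ]
  have hbound := D.abs_sum_ipSign_le σ hσ (fun _ => 1) (fun _ => 1) (by simp) (by simp)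
  have hlow : (4 : ℝ) ^ m / 3 ≤ ∑ u, ∑ v, 1 * 1 * (ipSign u v * σ (D.eval u v)) := by
    have hterm : ∀ q : BitStr m × BitStr m,
        2 * (if D.eval q.1 q.2 = (weight (bitAnd q.1 q.2) : ℤ) + K then (1 : ℝ) else 0) - 1 ≤
          1 * 1 * (ipSign q.1 q.2 * σ (D.eval q.1 q.2)) := by
      intro q
      rw [ipSign_eq]
      split_ifs with hq
      · simp only [hq, σ, add_sub_cancel_right, Int.natAbs_natCast]
        rw [← pow_add, Even.neg_one_pow ⟨_, rfl⟩]
        norm_num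
      · have : |(-1 : ℝ) ^ weight (bitAnd q.1 q.2) * σ (D.eval q.1 q.2)| = 1 := by
          simp [σ, abs_mul]
        have := neg_abs_le ((-1 : ℝ) ^ weight (bitAnd q.1 q.2) * σ (D.eval q.1 q.2))
        linarith
    have hs := sum_le_sum fun q (_ : q ∈ (univ : Finset (BitStr m × BitStr m))) => hterm q
    rw [sum_sub_distrib, ← mul_sum, sum_boole] at hs
    have hc : (Fintype.card (BitStr m × BitStr m) : ℝ) = 4 ^ m := by
      simp only [Fintype.card_prod, Fintype.card_fun, Fintype.card_bool, Fintype.card_fin]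
      push_cast
      rw [← mul_pow]
      norm_num
    rw [hc] at hcard
    have hone : ∑ _q : BitStr m × BitStr m, (1 : ℝ) = 4 ^ m := by
      rw [sum_const, nsmul_eq_mul, mul_one, card_univ, hc]
    rw [hone, Fintype.sum_prod_type] at hs
    refine le_trans ?_ hs
    linarith
  have hfin : (4 : ℝ) ^ m / 3 ≤ 2 ^ k * √(8 ^ m) := by
    rw [hcost, ← hk] at hbound
    exact hlow.trans ((le_abs_self _).trans hbound)
  have hsq : (2 : ℝ) ^ m ≤ 2 ^ (2 * k + 4) := by
    have h1 := pow_le_pow_left₀ (by positivity) hfin 2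
    rw [mul_pow, Real.sq_sqrt (by positivity)] at h1
    have h2 : ((4 : ℝ) ^ m / 3) ^ 2 = 2 ^ m / 9 * 8 ^ m := by
      rw [div_pow, ← pow_mul, mul_comm m 2, pow_mul]
      rw [div_mul_eq_mul_div, ← mul_pow]
      norm_num
    rw [h2] at h1
    have h3 := le_of_mul_le_mul_right h1 (by positivity)
    have h4 : (2 : ℝ) ^ (2 * k + 4) = 16 * (2 ^ k) ^ 2 := by ring
    rw [h4]
    nlinarith [sq_nonneg ((2 : ℝ) ^ k)]
  have hmk : m ≤ 2 * k + 4 := (pow_le_pow_iff_right₀ one_lt_two).1 hsq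
  exact_mod_cast (by omega : a ≤ 13 * k)

/-! ### Upper bound: exponential moments of the correlation test -/

theorem sum_sum_prod_eq_prod_sum_sum {ι κ : Type} [Fintype ι] [DecidableEq ι] [Fintype κ]
    (F : ι → κ → κ → ℝ) :
    ∑ r : ι → κ, ∑ s : ι → κ, ∏ i, F i (r i) (s i) = ∏ i, ∑ c, ∑ d, F i c d := by
  rw [Fintype.prod_sum]
  refine sum_congr rfl fun r _ => ?_
  rw [Fintype.prod_sum]

/-- The expectation factors over coordinates. When `i = j` that coordinate contributes the
correlation `ρ`; when they differ, coordinate `i` contributes the mean of a single unbiased sign. -/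
theorem sum_dsbsString_mul_bitSign (ρ : ℝ) {n : ℕ} (i j : Fin n) :
    ∑ r : BitStr n, ∑ s : BitStr n, dsbsString ρ r s * (bitSign (r i) * bitSign (s j)) =
      if i = j then ρ else 0 := by
  have h : ∀ r s : BitStr n, dsbsString ρ r s * (bitSign (r i) * bitSign (s j)) =
      ∏ k, dsbs ρ (r k) (s k) *
        ((if k = i then bitSign (r k) else 1) * if k = j then bitSign (s k) else 1) := by
    intro r s
    rw [prod_mul_distrib, prod_mul_distrib, prod_ite_eq', prod_ite_eq', if_pos (mem_univ _),
      if_pos (mem_univ _)]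
    rfl
  simp only [h]
  rw [sum_sum_prod_eq_prod_sum_sum fun k c d => dsbs ρ c d *
    ((if k = i then bitSign c else 1) * if k = j then bitSign d else 1)]
  split_ifs with hij
  · subst hij
    rw [prod_eq_single i]
    · simp [dsbs, bitSign]
      ring
    · intro k _ hk
      simp [dsbs, hk]
      ring
    · simp
  · refine prod_eq_zero (mem_univ i) ?_
    simp [dsbs, bitSign, hij]
    ring

/-- A function of a sign is affine in it, so exponential moments reduce to the second moment above.
-/
theorem exp_mul_bitSign (l : ℝ) (c d : Bool) :
    Real.exp (l * (bitSign c * bitSign d)) =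
      Real.cosh l + Real.sinh l * (bitSign c * bitSign d) := by
  rw [bitSign_mul_bitSign]
  split_ifs
  · rw [mul_one, mul_one, Real.cosh_add_sinh]
  · rw [mul_neg_one, mul_neg_one, ← sub_eq_add_neg, Real.cosh_sub_sinh]

theorem sum_dsbsString_mul_exp (ρ l : ℝ) {n : ℕ} (i j : Fin n) :
    ∑ r : BitStr n, ∑ s : BitStr n,
        dsbsString ρ r s * Real.exp (l * (bitSign (r i) * bitSign (s j))) =
      Real.cosh l + Real.sinh l * if i = j then ρ else 0 := by
  have h : ∀ r s : BitStr n, dsbsString ρ r s * Real.exp (l * (bitSign (r i) * bitSign (s j))) =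
      Real.cosh l * dsbsString ρ r s +
        Real.sinh l * (dsbsString ρ r s * (bitSign (r i) * bitSign (s j))) := fun r s => by
    rw [exp_mul_bitSign]
    ring
  simp only [h, sum_add_distrib, ← mul_sum]
  rw [sum_dsbsString, sum_dsbsString_mul_bitSign, mul_one]

/-- A string of `L * n` bits as `L` strings of `n` bits. -/
def blocks (L n : ℕ) : BitStr (L * n) ≃ (Fin L → BitStr n) :=
  (Equiv.arrowCongr finProdFinEquiv.symm (Equiv.refl Bool)).trans (Equiv.curry _ _ _)

theorem dsbsString_eq_prod_blocks (ρ : ℝ) {L n : ℕ} (r s : BitStr (L * n)) :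
    dsbsString ρ r s = ∏ l, dsbsString ρ (blocks L n r l) (blocks L n s l) := by
  simp only [dsbsString]
  rw [← finProdFinEquiv.prod_comp, Fintype.prod_prod_type]
  rfl

/-- The correlation of Alice's bits at position `i` with Bob's bits at position `j`. -/
def corr {L n : ℕ} (r s : BitStr (L * n)) (i j : Fin n) : ℝ :=
  ∑ l, bitSign (blocks L n r l i) * bitSign (blocks L n s l j)

theorem sum_dsbsString_mul_exp_corr (ρ h : ℝ) {L n : ℕ} (i j : Fin n) :
    ∑ r : BitStr (L * n), ∑ s : BitStr (L * n), dsbsString ρ r s * Real.exp (h * corr r s i j) =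
      (Real.cosh h + Real.sinh h * if i = j then ρ else 0) ^ L := by
  have hfac : ∀ r s : BitStr (L * n), dsbsString ρ r s * Real.exp (h * corr r s i j) =
      ∏ l, (dsbsString ρ (blocks L n r l) (blocks L n s l) *
        Real.exp (h * (bitSign (blocks L n r l i) * bitSign (blocks L n s l j)))) := by
    intro r s
    rw [dsbsString_eq_prod_blocks, corr, mul_sum, Real.exp_sum, prod_mul_distrib]
  simp only [hfac]
  calc _ = ∑ r : Fin L → BitStr n, ∑ s : Fin L → BitStr n, ∏ l, (dsbsString ρ (r l) (s l) *
        Real.exp (h * (bitSign (r l i) * bitSign (s l j)))) :=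
        Fintype.sum_equiv (blocks L n) _ _ fun r => Fintype.sum_equiv (blocks L n) _ _ fun s => rfl
    _ = _ := by
        rw [sum_sum_prod_eq_prod_sum_sum fun _ c d => dsbsString ρ c d *
          Real.exp (h * (bitSign (c i) * bitSign (d j)))]
        simp only [sum_dsbsString_mul_exp, prod_const, card_univ, Fintype.card_fin]

theorem exp_mul_cosh_le {ρ : ℝ} :
    Real.exp (-(ρ / 2 * (ρ / 2))) * Real.cosh (ρ / 2) ≤ Real.exp (-(ρ ^ 2 / 16)) := by
  calc Real.exp (-(ρ / 2 * (ρ / 2))) * Real.cosh (ρ / 2)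
      ≤ Real.exp (-(ρ / 2 * (ρ / 2))) * Real.exp ((ρ / 2) ^ 2 / 2) :=
        mul_le_mul_of_nonneg_left (Real.cosh_le_exp_half_sq _) (Real.exp_pos _).le
    _ = Real.exp (-(ρ ^ 2 / 8)) := by
        rw [← Real.exp_add]
        ring_nf
    _ ≤ Real.exp (-(ρ ^ 2 / 16)) := Real.exp_le_exp.2 (by nlinarith [sq_nonneg ρ])

/-- The lower tail per sample. With `y = ρ ^ 2 / 4`, the bracket is at most `1 + 3 / 4 * y - 2 * y ≤
exp (-(5 / 4 * y))`; the prefactor `exp y` leaves `exp (-(y / 4))`. This is the weaker of the two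
tails and fixes the rate `ρ ^ 2 / 16`. -/
theorem exp_mul_cosh_sub_sinh_le {ρ : ℝ} (h0 : 0 ≤ ρ) (h1 : ρ ≤ 1) :
    Real.exp (ρ / 2 * (ρ / 2)) * (Real.cosh (ρ / 2) - Real.sinh (ρ / 2) * ρ) ≤
      Real.exp (-(ρ ^ 2 / 16)) := by
  set y := ρ ^ 2 / 4 with hy
  have hy0 : 0 ≤ y := by positivity
  have hy1 : y ≤ 1 / 4 := by nlinarith
  have hs : ρ / 2 ≤ Real.sinh (ρ / 2) := Real.self_le_sinh_iff.2 (by linarith)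
  have hc : Real.cosh (ρ / 2) ≤ 1 + 3 / 4 * y := by
    calc Real.cosh (ρ / 2) ≤ Real.exp ((ρ / 2) ^ 2 / 2) := Real.cosh_le_exp_half_sq _
      _ = Real.exp (y / 2) := by rw [hy]; ring_nf
      _ ≤ 1 / (1 - y / 2) :=
          Real.exp_bound_div_one_sub_of_interval (by linarith) (by linarith)
      _ ≤ 1 + 3 / 4 * y := by
          rw [div_le_iff₀ (by linarith)]
          nlinarith
  have hmain : Real.cosh (ρ / 2) - Real.sinh (ρ / 2) * ρ ≤ Real.exp (-(5 / 4 * y)) := by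
    have h3 : -(5 / 4 * y) + 1 ≤ Real.exp (-(5 / 4 * y)) := Real.add_one_le_exp _
    have h4 : ρ / 2 * ρ ≤ Real.sinh (ρ / 2) * ρ := mul_le_mul_of_nonneg_right hs h0
    have h5 : ρ / 2 * ρ = 2 * y := by rw [hy]; ring
    linarith
  calc Real.exp (ρ / 2 * (ρ / 2)) * (Real.cosh (ρ / 2) - Real.sinh (ρ / 2) * ρ)
      ≤ Real.exp (ρ / 2 * (ρ / 2)) * Real.exp (-(5 / 4 * y)) :=
        mul_le_mul_of_nonneg_left hmain (Real.exp_pos _).le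
    _ = Real.exp (-(ρ ^ 2 / 16)) := by
        rw [← Real.exp_add, hy]
        ring_nf

/-- Chernoff bound for the correlation test. -/
theorem sum_wrong_le {ρ : ℝ} (h0 : 0 ≤ ρ) (h1 : ρ ≤ 1) {L n : ℕ} (i j : Fin n) :
    (∑ r : BitStr (L * n), ∑ s : BitStr (L * n),
      if (ρ * L / 2 ≤ corr r s i j ↔ i = j) then 0 else dsbsString ρ r s) ≤
      Real.exp (-(ρ ^ 2 / 16) * L) := by
  -- Markov's inequality for both tails at once: `h` is taken negative when a wrong verdict means
  -- too little correlation, positive when it means too much.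
  have chernoff : ∀ h : ℝ,
      (∀ r s : BitStr (L * n), ¬ (ρ * L / 2 ≤ corr r s i j ↔ i = j) →
        0 ≤ h * (corr r s i j - ρ * L / 2)) →
      (∑ r : BitStr (L * n), ∑ s : BitStr (L * n),
        if (ρ * L / 2 ≤ corr r s i j ↔ i = j) then 0 else dsbsString ρ r s) ≤
      (Real.exp (-(h * (ρ / 2))) *
        (Real.cosh h + Real.sinh h * if i = j then ρ else 0)) ^ L := by
    intro h hh
    have hexp : Real.exp (-(h * (ρ / 2))) ^ L = Real.exp (-(h * (ρ * L / 2))) := by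
      rw [← Real.exp_nat_mul]
      ring_nf
    rw [mul_pow, hexp, ← sum_dsbsString_mul_exp_corr, mul_sum]
    refine sum_le_sum fun r _ => ?_
    rw [mul_sum]
    refine sum_le_sum fun s _ => ?_
    rw [mul_left_comm, ← Real.exp_add]
    split_ifs with hw
    · exact mul_nonneg (dsbsString_nonneg h0 h1 _ _) (Real.exp_pos _).le
    · refine le_mul_of_one_le_right (dsbsString_nonneg h0 h1 _ _) (Real.one_le_exp ?_)
      have := hh r s hw
      linarith
  rw [mul_comm (-(ρ ^ 2 / 16)) (L : ℝ), Real.exp_nat_mul]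
  by_cases hij : i = j
  · refine (chernoff (-(ρ / 2)) fun r s hw => ?_).trans (pow_le_pow_left₀ ?_ ?_ _)
    · have : corr r s i j < ρ * L / 2 := by
        by_contra! hc
        exact hw (iff_of_true hc hij)
      nlinarith
    · rw [if_pos hij, Real.cosh_neg, Real.sinh_neg]
      refine mul_nonneg (Real.exp_pos _).le ?_
      have h2 := Real.sinh_lt_cosh (ρ / 2)
      have h3 : 0 ≤ Real.sinh (ρ / 2) := Real.sinh_nonneg_iff.2 (by linarith)
      nlinarith
    · rw [if_pos hij, Real.cosh_neg, Real.sinh_neg, neg_mul, neg_neg, neg_mul, ← sub_eq_add_neg]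
      exact exp_mul_cosh_sub_sinh_le h0 h1
  · refine (chernoff (ρ / 2) fun r s hw => ?_).trans (pow_le_pow_left₀ ?_ ?_ _)
    · have : ρ * L / 2 ≤ corr r s i j := by
        by_contra! hc
        exact hw (iff_of_false (not_le.2 hc) hij)
      nlinarith
    · rw [if_neg hij, mul_zero, add_zero]
      exact mul_nonneg (Real.exp_pos _).le (Real.cosh_pos _).le
    · rw [if_neg hij, mul_zero, add_zero]
      exact exp_mul_cosh_le

/-! ### Upper bound: the protocol -/

theorem exists_enumeration {n a : ℕ} (hn : 0 < n) :
    ∃ enum : BitStr n → Fin a → Fin n, ∀ x, weight x = a →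
      ∀ i, x i = true ↔ ∃ k, enum x k = i := by
  classical
  refine ⟨fun x => if h : weight x = a then (univ.filter fun i => x i = true).orderEmbOfFin h
    else fun _ => ⟨0, hn⟩, fun x h i => ?_⟩
  have := Set.ext_iff.1 ((univ.filter fun i => x i = true).range_orderEmbOfFin h) i
  simp only [dif_pos h]
  simpa using this.symm

theorem isrAchievable_oneWay_ssi {ρ : ℝ} (h0 : 0 ≤ ρ) (h1 : ρ ≤ 1) {n a b L : ℕ} (hn : 0 < n)
    (hL : a * b * Real.exp (-(ρ ^ 2 / 16) * L) ≤ 1 / 3) :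
    ISRAchievable .oneWay ρ (ssi n a b) (a * L) := by
  classical
  obtain ⟨enum, henum⟩ := exists_enumeration (a := a) hn
  obtain ⟨P, hP, hcost, heval⟩ := Protocol.exists_oneWay_of_message
    (A := BitStr n × BitStr (L * n)) (B := BitStr n × BitStr (L * n)) (Z := ℤ) (K := a * L)
    -- The message lists Alice's `L` source bits at each of her `a` positions, without naming the
    -- positions.
    ((blocks a L).symm ∘ fun v k l => blocks L n v.2 l (enum v.1 k))
    fun w v => #{j | v.1 j = true ∧ ∃ k, ρ * L / 2 ≤
      ∑ l, bitSign (blocks a L w k l) * bitSign (blocks L n v.2 l j)}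
  refine ⟨L * n, P, hP, hcost, fun x y z hz => ?_⟩
  have hxy : weight x = a ∧ weight y = b := by
    by_contra hc
    rw [ssi, if_neg hc] at hz
    exact Option.some_ne_none _ hz.symm
  rw [ssi, if_pos hxy, Option.some_inj] at hz
  subst hz
  have hgood : ∀ r s : BitStr (L * n),
      (∀ i j, x i = true → y j = true → (ρ * L / 2 ≤ corr r s i j ↔ i = j)) →
      P.eval (x, r) (y, s) = (weight (bitAnd x y) : ℤ) := by
    intro r s hrs
    rw [heval, weight]
    congr 2
    ext j
    simp only [mem_filter, mem_univ, true_and, Function.comp_apply, Equiv.apply_symm_apply,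
      bitAnd, Bool.and_eq_true]
    constructor
    · rintro ⟨hj, k, hk⟩
      have hx := (henum x hxy.1 (enum x k)).2 ⟨k, rfl⟩
      have := (hrs (enum x k) j hx hj).1 hk
      exact ⟨this ▸ hx, hj⟩
    · rintro ⟨hx, hj⟩
      obtain ⟨k, rfl⟩ := (henum x hxy.1 j).1 hx
      exact ⟨hj, k, (hrs _ _ hx hj).2 rfl⟩
  -- Pointwise union bound: an error requires a wrong verdict on some pair of positions from the two
  -- sets.
  have hpoint : ∀ r s : BitStr (L * n), dsbsString ρ r s ≤
      (if P.eval (x, r) (y, s) = (weight (bitAnd x y) : ℤ) then dsbsString ρ r s else 0) +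
        ∑ i with x i = true, ∑ j with y j = true,
          if (ρ * L / 2 ≤ corr r s i j ↔ i = j) then 0 else dsbsString ρ r s := by
    intro r s
    have hd := dsbsString_nonneg h0 h1 r s
    have hterm : ∀ i j, 0 ≤ if (ρ * L / 2 ≤ corr r s i j ↔ i = j) then 0 else
        dsbsString ρ r s := fun i j => by split_ifs <;> simp [hd]
    by_cases hc : P.eval (x, r) (y, s) = (weight (bitAnd x y) : ℤ)
    · rw [if_pos hc]
      exact le_add_of_nonneg_right (sum_nonneg fun i _ => sum_nonneg fun j _ => hterm i j)
    · rw [if_neg hc, zero_add]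
      have := mt (hgood r s) hc
      simp only [not_forall] at this
      obtain ⟨i, j, hi, hj, hij⟩ := this
      calc dsbsString ρ r s
          = if (ρ * L / 2 ≤ corr r s i j ↔ i = j) then 0 else dsbsString ρ r s :=
            (if_neg hij).symm
        _ ≤ ∑ j with y j = true,
              if (ρ * L / 2 ≤ corr r s i j ↔ i = j) then 0 else dsbsString ρ r s :=
            single_le_sum (f := fun j => if (ρ * L / 2 ≤ corr r s i j ↔ i = j) then 0 else
              dsbsString ρ r s) (fun j _ => hterm i j) (by simpa using hj)
        _ ≤ _ :=
            single_le_sum (f := fun i => ∑ j with y j = true,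
              if (ρ * L / 2 ≤ corr r s i j ↔ i = j) then 0 else dsbsString ρ r s)
              (fun i _ => sum_nonneg fun j _ => hterm i j) (by simpa using hi)
  have hsum := sum_le_sum fun r (_ : r ∈ (univ : Finset (BitStr (L * n)))) =>
    sum_le_sum fun s (_ : s ∈ (univ : Finset (BitStr (L * n)))) => hpoint r s
  simp only [sum_add_distrib] at hsum
  rw [sum_dsbsString] at hsum
  have hbad : ∑ r : BitStr (L * n), ∑ s : BitStr (L * n),
      ∑ i with x i = true, ∑ j with y j = true,
        (if (ρ * L / 2 ≤ corr r s i j ↔ i = j) then 0 else dsbsString ρ r s) ≤ 1 / 3 := by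
    calc _ = ∑ i with x i = true, ∑ j with y j = true,
          ∑ r : BitStr (L * n), ∑ s : BitStr (L * n),
            (if (ρ * L / 2 ≤ corr r s i j ↔ i = j) then 0 else dsbsString ρ r s) := by
          simp only [sum_comm (s := (univ : Finset (BitStr (L * n)))) (t := filter _ _)]
      _ ≤ ∑ i with x i = true, ∑ j with y j = true, Real.exp (-(ρ ^ 2 / 16) * L) :=
          sum_le_sum fun i _ => sum_le_sum fun j _ => sum_wrong_le h0 h1 i j
      _ = a * b * Real.exp (-(ρ ^ 2 / 16) * L) := by
          have hx : #{i | x i = true} = a := hxy.1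
          have hy : #{i | y i = true} = b := hxy.2
          rw [sum_const, sum_const, hx, hy, nsmul_eq_mul, nsmul_eq_mul, mul_assoc]
      _ ≤ 1 / 3 := hL
  linarith

theorem isrCC_oneWay_ssi_le {ρ : ℝ} (h0 : 0 < ρ) (h1 : ρ ≤ 1) {n a b : ℕ} (ha : 1 ≤ a)
    (hb : 1 ≤ b) (han : 2 * a ≤ n) :
    (isrCC .oneWay ρ (ssi n a b) : ℝ) ≤
      (48 / ρ ^ 2 + 1) * (a * max 1 (Real.logb 2 (a * b))) := by
  have ha' : (1 : ℝ) ≤ a := by exact_mod_cast ha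
  have hb' : (1 : ℝ) ≤ b := by exact_mod_cast hb
  have hab : (1 : ℝ) ≤ a * b := one_le_mul_of_one_le_of_one_le ha' hb'
  set M := max 1 (Real.logb 2 (a * b)) with hM
  have hM1 : 1 ≤ M := le_max_left _ _
  have hρ : 0 < ρ ^ 2 := by positivity
  -- Chosen so that each of the `a * b` tests fails with probability at most `1 / (3 * a * b)`.
  set L := ⌈16 / ρ ^ 2 * Real.log (3 * (a * b))⌉₊ with hLdef
  have hlog0 : 0 ≤ Real.log (3 * (a * b)) := Real.log_nonneg (by linarith)
  have hlog : Real.log (3 * (a * b)) ≤ 3 * M := by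
    rw [Real.log_mul (by norm_num) (by linarith)]
    have h3 : Real.log 3 ≤ 2 := by
      have := Real.log_le_sub_one_of_pos (show (0 : ℝ) < 3 by norm_num)
      linarith
    have h4 : Real.log (a * b) ≤ M := by
      have h5 : Real.log (a * b) = Real.logb 2 (a * b) * Real.log 2 := by
        rw [Real.logb, div_mul_cancel₀ _ (Real.log_pos one_lt_two).ne']
      have h6 : 0 ≤ Real.logb 2 (a * b) := Real.logb_nonneg one_lt_two hab
      have h7 : Real.logb 2 (a * b) ≤ M := le_max_right _ _
      have h8 := Real.log_two_lt_d9
      rw [h5]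
      nlinarith
    linarith
  have hLge : 16 / ρ ^ 2 * Real.log (3 * (a * b)) ≤ L := Nat.le_ceil _
  have hLle : (L : ℝ) ≤ (48 / ρ ^ 2 + 1) * M := by
    have h2 : (L : ℝ) < 16 / ρ ^ 2 * Real.log (3 * (a * b)) + 1 :=
      Nat.ceil_lt_add_one (by positivity)
    have h3 : 16 / ρ ^ 2 * Real.log (3 * (a * b)) ≤ 16 / ρ ^ 2 * (3 * M) :=
      mul_le_mul_of_nonneg_left hlog (by positivity)
    have h4 : (48 / ρ ^ 2 + 1) * M = 16 / ρ ^ 2 * (3 * M) + M := by ring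
    linarith
  have hach := isrAchievable_oneWay_ssi (L := L) h0.le h1 (a := a) (b := b) (n := n) (by omega) (by
    have h2 : Real.log (3 * (a * b)) ≤ ρ ^ 2 / 16 * L := by
      have := mul_le_mul_of_nonneg_left hLge (show 0 ≤ ρ ^ 2 / 16 by positivity)
      rwa [← mul_assoc, show ρ ^ 2 / 16 * (16 / ρ ^ 2) = 1 by field_simp, one_mul] at this
    have h3 : Real.exp (-(ρ ^ 2 / 16) * L) ≤ (3 * (a * b) : ℝ)⁻¹ := by
      rw [← Real.exp_log (show (0 : ℝ) < 3 * (a * b) by linarith), ← Real.exp_neg]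
      exact Real.exp_le_exp.2 (by linarith)
    calc a * b * Real.exp (-(ρ ^ 2 / 16) * L) ≤ a * b * (3 * (a * b) : ℝ)⁻¹ := by gcongr
      _ = 1 / 3 := by field_simp)
  have hle : (isrCC .oneWay ρ (ssi n a b) : ℝ) ≤ (a * L : ℕ) := by
    exact_mod_cast Nat.sInf_le hach
  refine hle.trans ?_
  push_cast
  calc (a : ℝ) * L ≤ a * ((48 / ρ ^ 2 + 1) * M) := by gcongr
    _ = _ := by ring

end SmallSet

/-! ### Assembly of the bounds -/

theorem mainTheorem9 :
    ∃ c : ℝ, 0 < c ∧ ∀ ρ : ℝ, 0 < ρ → ρ ≤ 1 →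
      ∃ C : ℝ, 0 < C ∧ ∀ n a b : ℕ, 1 ≤ a → 1 ≤ b →
        (a : ℝ) ≤ (n : ℝ) / 2 → (b : ℝ) ≤ (n : ℝ) / 2 →
        (c * max (a : ℝ) (Real.logb 2 b) ≤ SmallSet.randCC .oneWay (SmallSet.ssi n a b) ∧
          SmallSet.randCC .oneWay (SmallSet.ssi n a b) ≤
            SmallSet.isrCC .oneWay ρ (SmallSet.ssi n a b) ∧
          (SmallSet.isrCC .oneWay ρ (SmallSet.ssi n a b) : ℝ) ≤
            C * (a * max 1 (Real.logb 2 (a * b)))) ∧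
        (a ≤ b →
          c * max (a : ℝ) (Real.logb 2 b) ≤ SmallSet.randCC .twoWay (SmallSet.ssi n a b) ∧
          SmallSet.randCC .twoWay (SmallSet.ssi n a b) ≤
            SmallSet.isrCC .twoWay ρ (SmallSet.ssi n a b) ∧
          (SmallSet.isrCC .twoWay ρ (SmallSet.ssi n a b) : ℝ) ≤
            C * (a * max 1 (Real.logb 2 (a * b)))) := by
  refine ⟨1 / 37, by norm_num, fun ρ h0 h1 => ⟨48 / ρ ^ 2 + 1, by positivity,
    fun n a b ha hb han hbn => ?_⟩⟩
  have han' : 2 * a ≤ n := by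
    have : (2 : ℝ) * a ≤ n := by linarith
    exact_mod_cast this
  have hbn' : 2 * b ≤ n := by
    have : (2 : ℝ) * b ≤ n := by linarith
    exact_mod_cast this
  have hup := SmallSet.isrCC_oneWay_ssi_le h0 h1 ha hb han'
  have htwo : a ≤ b → 1 / 37 * max (a : ℝ) (Real.logb 2 b) ≤
      SmallSet.randCC .twoWay (SmallSet.ssi n a b) := fun hab => by
    have h2 := SmallSet.le_mul_randCC_twoWay_ssi ha hab hbn'
    have h3 := SmallSet.logb_le_mul_randCC_twoWay_ssi ha hab hbn'
    have h4 : (0 : ℝ) ≤ SmallSet.randCC .twoWay (SmallSet.ssi n a b) := Nat.cast_nonneg _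
    have : max (a : ℝ) (Real.logb 2 b) ≤ 37 * SmallSet.randCC .twoWay (SmallSet.ssi n a b) :=
      max_le (by linarith) (by linarith)
    linarith
  refine ⟨⟨?_, SmallSet.randCC_le_isrCC _ h0.le h1 _, hup⟩, fun hab => ⟨htwo hab,
    SmallSet.randCC_le_isrCC _ h0.le h1 _, le_trans ?_ hup⟩⟩
  · rcases le_total a b with hab | hba
    · exact (htwo hab).trans (by exact_mod_cast SmallSet.randCC_twoWay_le_oneWay _)
    · have h2 := SmallSet.le_mul_randCC_oneWay_ssi hb hba han'
      have h3 : Real.logb 2 b ≤ a := by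
        have h4 : (b : ℝ) ≤ 2 ^ a := by exact_mod_cast hba.trans Nat.lt_two_pow_self.le
        have := Real.logb_le_logb_of_le one_lt_two (by exact_mod_cast hb) h4
        rwa [Real.logb_pow, Real.logb_self_eq_one one_lt_two, mul_one] at this
      rw [max_eq_left h3]
      linarith
  · exact_mod_cast SmallSet.isrCC_twoWay_le_oneWay ρ _
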